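/- Let $n\ge 3$ and $1\le k\le n$ be integers. For $\lambda\in\mathbb R^n$ let $\sigma_j(\lambda)=\sum_{i_1<\dots<i_j}\lambda_{i_1}\cdots\lambda_{i_j}$ be the $j$-th elementary symmetric polynomial, and let $\Gamma_k=\{\lambda\in\mathbb R^n : \sigma_j(\lambda)>0 \text{ for } j=1,\dots,k\}$. For a positive function $u\in C^3(\mathbb R^n)$ let $\lambda(x)=(\lambda_1(x),\dots,\lambda_n(x))$ be the eigenvalues, counted with multiplicity, of the symmetric matrix $$\nabla^2u(x)-\frac{|\nabla u(x)|^2}{2u(x)}\,I .$$ Suppose that $u$ is $k$-admissible in the degenerate sense, i.e. $\lambda(x)\in\overline{\Gamma_k}$ for every $x\in\mathbb R^n$, and that $$\sigma_k(\lambda(x))=0\qquad\text{for every }x\in\mathbb R^n .$$ Then $u$ is constant. -/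

import Mathlib

noncomputable section

namespace KYamabe

/-- The `k`-th elementary symmetric polynomial `σ_k(lam)` of `lam ∈ ℝⁿ`:
the sum over all `k`-element sets of indices of the products of the corresponding entries. -/
def sigma {n : ℕ} (k : ℕ) (lam : Fin n → ℝ) : ℝ :=
  ∑ s ∈ Finset.powersetCard k (Finset.univ : Finset (Fin n)), ∏ i ∈ s, lam i

/-- The open cone `Γ_k = {lam ∈ ℝⁿ : σ_j(lam) > 0 for j = 1, …, k}`. -/
def gammaCone (n k : ℕ) : Set (Fin n → ℝ) :=
  {lam | ∀ j : ℕ, 1 ≤ j → j ≤ k → 0 < sigma j lam}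

/-- The Hessian matrix `(∂_i ∂_j u (x))` in the standard coordinates of `ℝⁿ`. -/
def hessian {n : ℕ} (u : EuclideanSpace ℝ (Fin n) → ℝ) (x : EuclideanSpace ℝ (Fin n)) :
    Matrix (Fin n) (Fin n) ℝ :=
  Matrix.of fun i j =>
    fderiv ℝ (fderiv ℝ u) x (EuclideanSpace.single i 1) (EuclideanSpace.single j 1)

/-- The matrix `U = ∇²u − |∇u|² / (2u) · I` at the point `x`. For `u > 0`, `U = u A_g`, where
`A_g` is the Schouten tensor of the conformally flat metric `g = u⁻² |dx|²`. -/
def conformalHessian {n : ℕ} (u : EuclideanSpace ℝ (Fin n) → ℝ)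
    (x : EuclideanSpace ℝ (Fin n)) : Matrix (Fin n) (Fin n) ℝ :=
  hessian u x - (‖gradient u x‖ ^ 2 / (2 * u x)) • (1 : Matrix (Fin n) (Fin n) ℝ)

theorem conformalHessian_isHermitian {n : ℕ} {u : EuclideanSpace ℝ (Fin n) → ℝ}
    (hu : ContDiff ℝ 2 u) (x : EuclideanSpace ℝ (Fin n)) :
    (conformalHessian u x).IsHermitian := by
  have hs : IsSymmSndFDerivAt ℝ u x := hu.contDiffAt.isSymmSndFDerivAt (by simp)
  have hH : (hessian u x).IsHermitian := by
    ext i j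
    simp only [hessian, Matrix.conjTranspose_apply, Matrix.of_apply, star_trivial]
    exact hs _ _
  refine hH.sub ?_
  ext i j
  simp [Matrix.one_apply, eq_comm]

/-- The vector `λ(∇²u − |∇u|² / (2u) · I)` of eigenvalues, with multiplicity, at the point `x`. -/
def conformalEigenvalues {n : ℕ} {u : EuclideanSpace ℝ (Fin n) → ℝ}
    (hu : ContDiff ℝ 2 u) (x : EuclideanSpace ℝ (Fin n)) : Fin n → ℝ :=
  (conformalHessian_isHermitian hu x).eigenvalues

/-- Entire `k`-admissibility in the sense appropriate to a degenerate equation: at every point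
the eigenvalues lie in the closure of `Γ_k`. (On the open cone itself `σ_k > 0`.) -/
def IsAdmissible {n : ℕ} (k : ℕ) {u : EuclideanSpace ℝ (Fin n) → ℝ}
    (hu : ContDiff ℝ 2 u) : Prop :=
  ∀ x, conformalEigenvalues hu x ∈ closure (gammaCone n k)

end KYamabe

end

/-!
The proof is a comparison of `u` with its Kelvin transforms. Write `U_u` for the conformal Hessian.
It is homogeneous of degree one in `u`, covariant under similarities and inversions
(`KYamabe.hasLineJet_kelvin`), and superadditive, since `|∇u|² / u` is jointly convex
(`KYamabe.norm_add_sq_div_le`). The main step is that the Kelvin transform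
`v(y) = |y|² u(y / |y|²)` satisfies `v ≤ u` in the unit ball (`IsDegenerateSolution.kelvin_le`).
Transported by similarities, this says that `u(c + r e) / r` is nonincreasing in `r` on every ray;
letting the vertex `c` recede to infinity gives `u(z) ≤ u(x)` for all `x` and `z`
(`IsDegenerateSolution.le`).

For the main step, let `h_p(x) = 1 + |x|² + ⟨p, x⟩` with `|p| ≤ 1`. These are bubbles: `U_{h_p}` is a
positive multiple of the identity. If a multiple `N u` touched `v + ε h_p` from above at some
`y ≠ 0`, then `N U_u ≥ U_v + ε U_{h_p}` there, and `U_v` is a rotated positive multiple of `U_u` at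
another point. By monotonicity of eigenvalues (`KYamabe.eigenvalue_mono`) and of `Γ_k`
(`KYamabe.gammaCone_mono`, a consequence of Newton's inequality) the eigenvalues of `U_u` at `y`
would lie in the open cone `Γ_k`, contradicting `σ_k = 0`. So if `v > u` somewhere, the supremum `N`
of `(v + ε h_p) / u` is approached only at the origin, and there it does not depend on `p`.
Optimising over `p` gives `v ≤ N u - ε (1 + |x|²) - ε |x|`, with a gap tending to `0` along some
sequence. This contradicts superharmonicity of `v ^ (-1/2)`, which holds because `n ≥ 3` and
`σ_1 ≥ 0`, together with the removability of an isolated singularity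
(`KYamabe.affine_le_rpow_neg_half`, `KYamabe.exists_gap_of_le_sub_norm`).
-/

noncomputable section

namespace KYamabe

open Filter Topology

/-! ### Newton's inequality and the cone `Γ_k` -/

theorem splits_derivative {p : Polynomial ℝ} (hp : p.Splits) :
    (Polynomial.derivative p).Splits := by
  rw [Polynomial.splits_iff_card_roots] at hp ⊢
  have h1 := Polynomial.card_roots_le_derivative p
  have h2 := Polynomial.natDegree_derivative_le p
  have h3 := Polynomial.card_roots' (Polynomial.derivative p)
  by_cases h0 : p.natDegree = 0
  · have : Polynomial.derivative p = 0 := Polynomial.derivative_of_natDegree_zero h0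
    simp [this]
  · omega

/-- Laguerre's inequality `p'² - p p'' ≥ 0` at the origin. -/
theorem two_mul_coeff_zero_mul_coeff_two_le {p : Polynomial ℝ} (hp : p.Splits) :
    2 * p.coeff 0 * p.coeff 2 ≤ p.coeff 1 ^ 2 := by
  unfold Polynomial.Splits at hp
  induction hp using Submonoid.closure_induction with
  | mem x hx =>
    rcases hx with ⟨a, rfl⟩ | ⟨a, rfl⟩
    · simp [Polynomial.coeff_C]
    · simp [Polynomial.coeff_C, Polynomial.coeff_X]
  | one => simp [Polynomial.coeff_one]
  | mul p q _ _ ihp ihq =>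
    have e1 : (p * q).coeff 1 = p.coeff 0 * q.coeff 1 + p.coeff 1 * q.coeff 0 := by
      simp [Polynomial.coeff_mul, Finset.Nat.antidiagonal_succ]
    have e2 : (p * q).coeff 2 =
        p.coeff 0 * q.coeff 2 + p.coeff 1 * q.coeff 1 + p.coeff 2 * q.coeff 0 := by
      simp [Polynomial.coeff_mul, Finset.Nat.antidiagonal_succ]
      ring
    rw [Polynomial.mul_coeff_zero, e1, e2]
    nlinarith [mul_nonneg (sq_nonneg (p.coeff 0)) (sub_nonneg.2 ihq),
      mul_nonneg (sq_nonneg (q.coeff 0)) (sub_nonneg.2 ihp)]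

/-- Newton's inequality in a form that passes from `p'` to `p` without loss. -/
theorem newton_coeff (k : ℕ) {p : Polynomial ℝ} (hp : p.Splits) :
    (k + 2) * (p.coeff k * p.coeff (k + 2)) ≤ (k + 1) * p.coeff (k + 1) ^ 2 := by
  induction k generalizing p with
  | zero =>
    have := two_mul_coeff_zero_mul_coeff_two_le hp
    norm_num
    linarith
  | succ k ih =>
    have h := ih (splits_derivative hp)
    simp only [Polynomial.coeff_derivative] at h
    have hk : (0 : ℝ) < (k + 1) * (k + 2) := by positivity
    push_cast at h ⊢
    refine le_of_mul_le_mul_left ?_ hk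
    have e1 : k + 2 + 1 = k + 1 + 2 := by ring
    rw [e1] at h
    linarith

theorem coeff_mul_coeff_le_sq (k : ℕ) {p : Polynomial ℝ} (hp : p.Splits) :
    p.coeff k * p.coeff (k + 2) ≤ p.coeff (k + 1) ^ 2 := by
  have h := newton_coeff k hp
  have hk : (0 : ℝ) ≤ k := k.cast_nonneg
  have := sq_nonneg (p.coeff (k + 1))
  by_contra! hlt
  nlinarith

/-- The generating polynomial `∏ i ∈ s, (1 + lam i X)`, whose coefficients are the elementary
symmetric polynomials of `lam` restricted to `s`. -/
def genPoly {ι : Type*} (s : Finset ι) (lam : ι → ℝ) : Polynomial ℝ :=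
  ∏ i ∈ s, (1 + Polynomial.C (lam i) * Polynomial.X)

theorem splits_genPoly {ι : Type*} (s : Finset ι) (lam : ι → ℝ) : (genPoly s lam).Splits := by
  refine Polynomial.Splits.prod fun i _ => ?_
  refine Polynomial.Splits.of_natDegree_le_one ?_
  compute_degree

theorem coeff_genPoly {ι : Type*} (s : Finset ι) (lam : ι → ℝ) (k : ℕ) :
    (genPoly s lam).coeff k = ∑ t ∈ Finset.powersetCard k s, ∏ i ∈ t, lam i := by
  classical
  rw [genPoly, Finset.prod_one_add, Polynomial.finsetSum_coeff, Finset.powersetCard_eq_filter,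
    Finset.sum_filter]
  refine Finset.sum_congr rfl fun t _ => ?_
  rw [Finset.prod_mul_distrib, Finset.prod_const, ← map_prod, Polynomial.coeff_C_mul_X_pow]
  simp [eq_comm]

theorem coeff_genPoly_univ {n : ℕ} (lam : Fin n → ℝ) (k : ℕ) :
    (genPoly Finset.univ lam).coeff k = sigma k lam :=
  coeff_genPoly _ _ _

theorem genPoly_univ_eq {n : ℕ} (lam : Fin n → ℝ) (i : Fin n) :
    genPoly Finset.univ lam =
      (1 + Polynomial.C (lam i) * Polynomial.X) * genPoly (Finset.univ.erase i) lam :=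
  (Finset.mul_prod_erase _ _ (Finset.mem_univ i)).symm

theorem sigma_succ_eq {n : ℕ} (lam : Fin n → ℝ) (i : Fin n) (k : ℕ) :
    sigma (k + 1) lam = (genPoly (Finset.univ.erase i) lam).coeff (k + 1) +
      lam i * (genPoly (Finset.univ.erase i) lam).coeff k := by
  rw [← coeff_genPoly_univ, genPoly_univ_eq lam i, add_mul, one_mul, Polynomial.coeff_add,
    mul_assoc, Polynomial.coeff_C_mul, Polynomial.coeff_X_mul]

/-- If `lam ∈ Γ_k`, then deleting one entry leaves an element of `Γ_{k-1}`. Otherwise there is a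
first `j` for which `σ_j` of the shortened vector is nonpositive, and the positivity of `σ_j(lam)`
and `σ_{j+1}(lam)` contradicts Newton's inequality. -/
theorem coeff_genPoly_erase_pos {n k : ℕ} {lam : Fin n → ℝ} (h : lam ∈ gammaCone n k)
    (i : Fin n) {j : ℕ} (hj : j < k) : 0 < (genPoly (Finset.univ.erase i) lam).coeff j := by
  induction j with
  | zero => simp [coeff_genPoly]
  | succ j ih =>
    have ih := ih (by omega)
    have h1 := h (j + 1) (by omega) (by omega)
    have h2 := h (j + 2) (by omega) (by omega)
    rw [sigma_succ_eq lam i] at h1 h2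
    have hN := coeff_mul_coeff_le_sq j (splits_genPoly (Finset.univ.erase i) lam)
    generalize (genPoly (Finset.univ.erase i) lam).coeff j = a at *
    generalize (genPoly (Finset.univ.erase i) lam).coeff (j + 1) = b at *
    generalize (genPoly (Finset.univ.erase i) lam).coeff (j + 2) = c at *
    by_contra! hb
    nlinarith [mul_pos ih h2, mul_nonneg (neg_nonneg.2 hb) h1.le]

theorem update_mem_gammaCone {n k : ℕ} {lam : Fin n → ℝ} (h : lam ∈ gammaCone n k)
    (i : Fin n) {t : ℝ} (ht : lam i ≤ t) : Function.update lam i t ∈ gammaCone n k := by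
  intro j hj hjk
  obtain ⟨j, rfl⟩ : ∃ m, j = m + 1 := ⟨j - 1, by omega⟩
  have e : genPoly (Finset.univ.erase i) (Function.update lam i t) =
      genPoly (Finset.univ.erase i) lam := by
    refine Finset.prod_congr rfl fun l hl => ?_
    rw [Function.update_of_ne (Finset.ne_of_mem_erase hl)]
  have h1 := h (j + 1) hj hjk
  have h2 := coeff_genPoly_erase_pos h i (j := j) (by omega)
  rw [sigma_succ_eq _ i] at h1 ⊢
  rw [e, Function.update_self]
  nlinarith

theorem gammaCone_mono {n k : ℕ} {lam mu : Fin n → ℝ} (h : lam ∈ gammaCone n k)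
    (hle : ∀ i, lam i ≤ mu i) : mu ∈ gammaCone n k := by
  suffices H : ∀ s : Finset (Fin n), (fun i => if i ∈ s then mu i else lam i) ∈ gammaCone n k by
    simpa using H Finset.univ
  intro s
  induction s using Finset.induction_on with
  | empty => simpa using h
  | insert a s ha ih =>
    have := update_mem_gammaCone ih a (t := mu a) (by simp [ha, hle])
    convert this using 1
    ext i
    by_cases hia : i = a
    · subst hia; simp
    · simp [hia]

theorem sigma_smul {n : ℕ} (k : ℕ) (c : ℝ) (lam : Fin n → ℝ) :
    sigma k (fun i => c * lam i) = c ^ k * sigma k lam := by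
  rw [sigma, sigma, Finset.mul_sum]
  refine Finset.sum_congr rfl fun t ht => ?_
  rw [Finset.prod_mul_distrib, Finset.prod_const, (Finset.mem_powersetCard.1 ht).2]

/-- A vector that dominates a positive multiple of a vector of `closure Γ_k` by a fixed positive
amount in every entry lies in the open cone `Γ_k`. -/
theorem mem_gammaCone_of_closure {n k : ℕ} {lam mu : Fin n → ℝ}
    (h : lam ∈ closure (gammaCone n k)) {κ c : ℝ} (hκ : 0 < κ) (hc : 0 < c)
    (hle : ∀ i, κ * lam i + c ≤ mu i) : mu ∈ gammaCone n k := by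
  obtain ⟨nu, hnu, hd⟩ := Metric.mem_closure_iff.1 h (c / κ) (by positivity)
  refine gammaCone_mono (lam := fun i => κ * nu i) ?_ fun i => ?_
  · intro j hj hjk
    rw [sigma_smul]
    exact mul_pos (pow_pos hκ _) (hnu j hj hjk)
  · have h1 : |lam i - nu i| < c / κ := lt_of_le_of_lt (dist_le_pi_dist lam nu i) hd
    rw [lt_div_iff₀ hκ] at h1
    nlinarith [hle i, neg_abs_le (lam i - nu i)]

theorem sum_nonneg_of_mem_closure {n k : ℕ} (hk : 1 ≤ k) {lam : Fin n → ℝ}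
    (h : lam ∈ closure (gammaCone n k)) : 0 ≤ ∑ i, lam i := by
  have hcl : IsClosed {mu : Fin n → ℝ | 0 ≤ ∑ i, mu i} :=
    isClosed_le continuous_const (by fun_prop)
  refine closure_minimal (fun mu hmu => ?_) hcl h
  have := hmu 1 le_rfl hk
  simp only [sigma, Finset.powersetCard_one, Finset.sum_map, Function.Embedding.coeFn_mk,
    Finset.prod_singleton] at this
  exact this.le

/-! ### Monotonicity of eigenvalues -/

/-- Weyl's monotonicity principle for two quadratic forms given in diagonal form, with the
eigenvalues of both in decreasing order along the same enumeration `σ` of the index set. For each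
`j` there is a vector `e ≠ 0` orthogonal to all `a i` before `j` and to all `b i` after `j`. -/
theorem eigenvalue_mono {ι E : Type*} [Fintype ι] [NormedAddCommGroup E] [InnerProductSpace ℝ E]
    {m : ℕ} (σ : ι ≃ Fin m) (a b : OrthonormalBasis ι ℝ E) {α β : ι → ℝ}
    (hα : ∀ i j, σ i ≤ σ j → α j ≤ α i) (hβ : ∀ i j, σ i ≤ σ j → β j ≤ β i)
    {κ c : ℝ} (hκ : 0 ≤ κ)
    (h : ∀ e, κ * ∑ i, β i * (inner ℝ (b i) e) ^ 2 + c * ‖e‖ ^ 2 ≤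
      ∑ i, α i * (inner ℝ (a i) e) ^ 2) (j : ι) : κ * β j + c ≤ α j := by
  classical
  have : FiniteDimensional ℝ E := a.toBasis.finiteDimensional_of_finite
  let f : E →ₗ[ℝ] ({i // i ≠ j} → ℝ) := LinearMap.pi fun i =>
    if σ i < σ j then (innerSL ℝ (a i) : E →ₗ[ℝ] ℝ) else (innerSL ℝ (b i) : E →ₗ[ℝ] ℝ)
  have hf : LinearMap.ker f ≠ ⊥ := by
    apply LinearMap.ker_ne_bot_of_finrank_lt
    rw [Module.finrank_fintype_fun_eq_card, Module.finrank_eq_card_basis a.toBasis]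
    exact Fintype.card_subtype_lt (x := j) (by simp)
  obtain ⟨e, he, he0⟩ := Submodule.exists_mem_ne_zero_of_ne_bot hf
  have hfe : ∀ i : {i // i ≠ j}, f e i = 0 := fun i => by
    rw [LinearMap.mem_ker.1 he]; rfl
  have ha : ∀ i, σ i < σ j → inner ℝ (a i) e = 0 := fun i hi => by
    have := hfe ⟨i, by rintro rfl; exact lt_irrefl _ hi⟩
    simpa [f, hi] using this
  have hb : ∀ i, σ j < σ i → inner ℝ (b i) e = 0 := fun i hi => by
    have := hfe ⟨i, by rintro rfl; exact lt_irrefl _ hi⟩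
    simpa [f, hi.not_gt] using this
  have hpos : 0 < ‖e‖ ^ 2 := by positivity
  have sa : ∑ i, (inner ℝ (a i) e) ^ 2 = ‖e‖ ^ 2 := by
    rw [← a.sum_sq_norm_inner_right e]; simp
  have sb : ∑ i, (inner ℝ (b i) e) ^ 2 = ‖e‖ ^ 2 := by
    rw [← b.sum_sq_norm_inner_right e]; simp
  have h1 : ∑ i, α i * (inner ℝ (a i) e) ^ 2 ≤ α j * ‖e‖ ^ 2 := by
    rw [← sa, Finset.mul_sum]
    refine Finset.sum_le_sum fun i _ => ?_
    rcases lt_or_ge (σ i) (σ j) with hi | hi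
    · simp [ha i hi]
    · exact mul_le_mul_of_nonneg_right (hα _ _ hi) (sq_nonneg _)
  have h2 : β j * ‖e‖ ^ 2 ≤ ∑ i, β i * (inner ℝ (b i) e) ^ 2 := by
    rw [← sb, Finset.mul_sum]
    refine Finset.sum_le_sum fun i _ => ?_
    rcases lt_or_ge (σ j) (σ i) with hi | hi
    · simp [hb i hi]
    · exact mul_le_mul_of_nonneg_right (hβ _ _ hi) (sq_nonneg _)
  have h3 := h e
  have h4 := mul_le_mul_of_nonneg_left h2 hκ
  refine le_of_mul_le_mul_right ?_ hpos
  linarith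

theorem inner_toEuclideanLin_eq_sum {n : ℕ} {A : Matrix (Fin n) (Fin n) ℝ} (hA : A.IsHermitian)
    (e : EuclideanSpace ℝ (Fin n)) :
    inner ℝ e (Matrix.toEuclideanLin A e) =
      ∑ i, hA.eigenvalues i * (inner ℝ (hA.eigenvectorBasis i) e) ^ 2 := by
  rw [← hA.eigenvectorBasis.sum_inner_mul_inner]
  refine Finset.sum_congr rfl fun i _ => ?_
  have h1 : Matrix.toEuclideanLin A (hA.eigenvectorBasis i) =
      hA.eigenvalues i • hA.eigenvectorBasis i := by
    ext l
    have := congrFun (hA.mulVec_eigenvectorBasis i) l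
    simpa [Matrix.toLpLin_apply] using this
  have h2 := (Matrix.isSymmetric_toEuclideanLin_iff.2 hA) (hA.eigenvectorBasis i) e
  rw [← h2, h1, real_inner_smul_left, real_inner_comm]
  ring

/-! ### The equation in terms of quadratic forms -/

/-- The quadratic form `e ↦ D²u(x)(e, e) - |∇u(x)|² / (2 u(x)) |e|²` of the conformal Hessian,
written without coordinates. -/
def conformalForm {n : ℕ} (u : EuclideanSpace ℝ (Fin n) → ℝ) (x e : EuclideanSpace ℝ (Fin n)) :
    ℝ :=
  fderiv ℝ (fderiv ℝ u) x e e - ‖gradient u x‖ ^ 2 / (2 * u x) * ‖e‖ ^ 2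

theorem inner_conformalHessian {n : ℕ} (u : EuclideanSpace ℝ (Fin n) → ℝ)
    (x e : EuclideanSpace ℝ (Fin n)) :
    inner ℝ e (Matrix.toEuclideanLin (conformalHessian u x) e) = conformalForm u x e := by
  have hexp : e = ∑ i, e i • EuclideanSpace.single i (1 : ℝ) := by
    have := (EuclideanSpace.basisFun (Fin n) ℝ).sum_repr e
    simpa using this.symm
  have hH : fderiv ℝ (fderiv ℝ u) x e e = ∑ i, ∑ j, e i * (hessian u x i j * e j) := by
    conv_lhs => rw [hexp]
    simp only [map_sum, map_smul, sum_apply, smul_apply,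
      smul_eq_mul, hessian, Matrix.of_apply, Finset.mul_sum]
    rw [Finset.sum_comm]
    refine Finset.sum_congr rfl fun i _ => Finset.sum_congr rfl fun j _ => ?_
    ring
  rw [conformalForm, hH, conformalHessian, map_sub, LinearMap.sub_apply, inner_sub_right]
  congr 1
  · simp only [Matrix.toLpLin_apply, PiLp.inner_apply, Matrix.mulVec, dotProduct,
      RCLike.inner_apply, conj_trivial, Finset.sum_mul]
    refine Finset.sum_congr rfl fun i _ => Finset.sum_congr rfl fun j _ => ?_
    ring
  · rw [map_smul, LinearMap.smul_apply, real_inner_smul_right, ← real_inner_self_eq_norm_sq]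
    congr 2
    simp

/-- What the comparison argument uses of a solution: the trace of the conformal Hessian is
nonnegative, and the conformal Hessian at one point never exceeds, by a positive multiple of the
identity, a rotated positive multiple of the conformal Hessian at another point. Unlike the
equation itself, both properties are visibly invariant under similarities of `ℝⁿ`. -/
structure IsDegenerateSolution {n : ℕ} (u : EuclideanSpace ℝ (Fin n) → ℝ) : Prop where
  contDiff : ContDiff ℝ 2 u
  pos : ∀ x, 0 < u x
  trace_nonneg : ∀ x, ∃ b : OrthonormalBasis (Fin n) ℝ (EuclideanSpace ℝ (Fin n)),
    0 ≤ ∑ i, conformalForm u x (b i)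
  not_lt : ∀ x z (R : EuclideanSpace ℝ (Fin n) ≃ₗᵢ[ℝ] EuclideanSpace ℝ (Fin n)) (κ c : ℝ),
    0 < κ → 0 < c →
    ¬ ∀ e, κ * conformalForm u z (R e) + c * ‖e‖ ^ 2 ≤ conformalForm u x e

theorem isDegenerateSolution_of_sigma_eq_zero {n k : ℕ} (hk : 1 ≤ k)
    {u : EuclideanSpace ℝ (Fin n) → ℝ} (hu : ContDiff ℝ 2 u) (hpos : ∀ x, 0 < u x)
    (hadm : IsAdmissible k hu) (heq : ∀ x, sigma k (conformalEigenvalues hu x) = 0) :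
    IsDegenerateSolution u where
  contDiff := hu
  pos := hpos
  trace_nonneg x := by
    refine ⟨(conformalHessian_isHermitian hu x).eigenvectorBasis, ?_⟩
    convert sum_nonneg_of_mem_closure hk (hadm x) using 2 with i
    rw [← inner_conformalHessian, inner_toEuclideanLin_eq_sum (conformalHessian_isHermitian hu x),
      Finset.sum_eq_single i]
    · simp [conformalEigenvalues]
    · intro j _ hji
      rw [(conformalHessian_isHermitian hu x).eigenvectorBasis.inner_eq_zero hji]
      ring
    · simp
  not_lt x z R κ c hκ hc hlt := by
    have hx := conformalHessian_isHermitian hu x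
    have hz := conformalHessian_isHermitian hu z
    have key : ∀ j, κ * hz.eigenvalues j + c ≤ hx.eigenvalues j := by
      refine eigenvalue_mono (α := hx.eigenvalues) (β := hz.eigenvalues) (Fintype.equivOfCardEq (Fintype.card_fin _)).symm
        hx.eigenvectorBasis (hz.eigenvectorBasis.map R.symm)
        (fun i j hij => hx.eigenvalues₀_antitone hij) (fun i j hij => hz.eigenvalues₀_antitone hij)
        hκ.le fun e => ?_
      have h := hlt e
      rw [← inner_conformalHessian, ← inner_conformalHessian, inner_toEuclideanLin_eq_sum hx,
        inner_toEuclideanLin_eq_sum hz] at h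
      have hR : ∀ i, inner ℝ (hz.eigenvectorBasis.map R.symm i) e =
          inner ℝ (hz.eigenvectorBasis i) (R e) := fun i => by
        rw [OrthonormalBasis.map_apply, ← R.inner_map_map, R.apply_symm_apply]
      simpa only [hR] using h
    have := mem_gammaCone_of_closure (hadm z) hκ hc (mu := conformalEigenvalues hu x) key
    have h1 := this k hk le_rfl
    rw [heq x] at h1
    exact lt_irrefl _ h1

/-! ### Second-order jets along lines -/

section LineJet

variable {E : Type*} [NormedAddCommGroup E] [InnerProductSpace ℝ E]

/-- `f` has gradient `g` and second directional derivatives `H e = D²f(y)(e, e)` at `y`, all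
derivatives being taken along the lines `t ↦ y + t e`. This is all that the second-derivative test
needs, and it turns the chain and product rules into one-variable calculus. -/
def HasLineJet (f : E → ℝ) (y g : E) (H : E → ℝ) : Prop :=
  ∀ e, ∃ f' : ℝ → ℝ, (∀ᶠ t in 𝓝 (0 : ℝ), HasDerivAt (fun t : ℝ => f (y + t • e)) (f' t) t) ∧
    f' 0 = inner ℝ g e ∧ HasDerivAt f' (H e) 0

theorem HasLineJet.add {f₁ f₂ : E → ℝ} {y g₁ g₂ : E} {H₁ H₂ : E → ℝ}
    (h₁ : HasLineJet f₁ y g₁ H₁) (h₂ : HasLineJet f₂ y g₂ H₂) :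
    HasLineJet (fun x => f₁ x + f₂ x) y (g₁ + g₂) (fun e => H₁ e + H₂ e) := by
  intro e
  obtain ⟨d₁, a₁, b₁, c₁⟩ := h₁ e
  obtain ⟨d₂, a₂, b₂, c₂⟩ := h₂ e
  refine ⟨fun t => d₁ t + d₂ t, ?_, ?_, c₁.add c₂⟩
  · filter_upwards [a₁, a₂] with t ht₁ ht₂ using ht₁.add ht₂
  · simp only [inner_add_left, b₁, b₂]

theorem HasLineJet.const_mul {f : E → ℝ} {y g : E} {H : E → ℝ} (h : HasLineJet f y g H) (c : ℝ) :
    HasLineJet (fun x => c * f x) y (c • g) (fun e => c * H e) := by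
  intro e
  obtain ⟨d, a, b, c'⟩ := h e
  refine ⟨fun t => c * d t, ?_, ?_, c'.const_mul c⟩
  · filter_upwards [a] with t ht using ht.const_mul c
  · simp only [real_inner_smul_left, b]

theorem HasLineJet.sub {f₁ f₂ : E → ℝ} {y g₁ g₂ : E} {H₁ H₂ : E → ℝ}
    (h₁ : HasLineJet f₁ y g₁ H₁) (h₂ : HasLineJet f₂ y g₂ H₂) :
    HasLineJet (fun x => f₁ x - f₂ x) y (g₁ - g₂) (fun e => H₁ e - H₂ e) := by
  simpa [sub_eq_add_neg] using h₁.add (h₂.const_mul (-1))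

theorem HasLineJet.scomp {f : E → ℝ} {y g : E} {H : E → ℝ} (h : HasLineJet f y g H)
    {φ φ' : ℝ → ℝ} {φ'' : ℝ} (hφ : ∀ᶠ s in 𝓝 (f y), HasDerivAt φ (φ' s) s)
    (hφ' : HasDerivAt φ' φ'' (f y)) :
    HasLineJet (fun x => φ (f x)) y (φ' (f y) • g)
      (fun e => φ'' * (inner ℝ g e) ^ 2 + φ' (f y) * H e) := by
  intro e
  obtain ⟨d, a, b, c⟩ := h e
  have a0 := a.self_of_nhds
  have hc : Tendsto (fun t : ℝ => f (y + t • e)) (𝓝 0) (𝓝 (f y)) := by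
    simpa using a0.continuousAt.tendsto
  refine ⟨fun t => φ' (f (y + t • e)) * d t, ?_, ?_, ?_⟩
  · filter_upwards [a, hc.eventually hφ] with t ht hs using hs.comp t ht
  · simp [b, real_inner_smul_left]
  · have h0 : HasDerivAt φ' φ'' (f (y + (0 : ℝ) • e)) := by simpa using hφ'
    have := (h0.comp (0 : ℝ) a0).mul c
    refine this.congr_deriv ?_
    simp only [Function.comp_apply, zero_smul, add_zero, b]
    ring

theorem hasLineJet_affine (a : ℝ) (p y : E) :
    HasLineJet (fun x => a + inner ℝ p x) y p (fun _ => 0) := by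
  intro e
  refine ⟨fun _ => inner ℝ p e, Eventually.of_forall fun t => ?_, rfl, hasDerivAt_const _ _⟩
  simp only [inner_add_right, real_inner_smul_right]
  simpa using (((hasDerivAt_id t).mul_const (inner ℝ p e)).const_add (inner ℝ p y)).const_add a

theorem norm_add_smul_sq (y e : E) (t : ℝ) :
    ‖y + t • e‖ ^ 2 = ‖y‖ ^ 2 + t * (2 * inner ℝ y e) + t ^ 2 * ‖e‖ ^ 2 := by
  rw [norm_add_sq_real, real_inner_smul_right, norm_smul, mul_pow, Real.norm_eq_abs, sq_abs]
  ring

theorem hasDerivAt_norm_add_smul_sq (y e : E) (t : ℝ) :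
    HasDerivAt (fun t : ℝ => ‖y + t • e‖ ^ 2) (2 * inner ℝ y e + 2 * t * ‖e‖ ^ 2) t := by
  simp only [norm_add_smul_sq]
  have := (((hasDerivAt_id t).mul_const (2 * inner ℝ y e)).const_add (‖y‖ ^ 2)).add
    ((hasDerivAt_pow 2 t).mul_const (‖e‖ ^ 2))
  exact this.congr_deriv (by simp)

theorem hasDerivAt_norm_add_smul_sq_deriv (y e : E) (t : ℝ) :
    HasDerivAt (fun t : ℝ => 2 * inner ℝ y e + 2 * t * ‖e‖ ^ 2) (2 * ‖e‖ ^ 2) t := by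
  simpa using (((hasDerivAt_id t).const_mul 2).mul_const (‖e‖ ^ 2)).const_add (2 * inner ℝ y e)

theorem hasLineJet_norm_sq (y : E) :
    HasLineJet (fun x => ‖x‖ ^ 2) y ((2 : ℝ) • y) (fun e => 2 * ‖e‖ ^ 2) := by
  intro e
  refine ⟨_, Eventually.of_forall fun t => hasDerivAt_norm_add_smul_sq y e t, ?_,
    hasDerivAt_norm_add_smul_sq_deriv y e 0⟩
  simp [real_inner_smul_left]

theorem hasLineJet_log_norm_sq {y : E} (hy : y ≠ 0) :
    HasLineJet (fun x => Real.log (‖x‖ ^ 2)) y ((‖y‖ ^ 2)⁻¹ • (2 : ℝ) • y)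
      (fun e => -(((‖y‖ ^ 2) ^ 2)⁻¹) * (inner ℝ ((2 : ℝ) • y) e) ^ 2 +
        (‖y‖ ^ 2)⁻¹ * (2 * ‖e‖ ^ 2)) := by
  have h0 : ‖y‖ ^ 2 ≠ 0 := by positivity
  refine (hasLineJet_norm_sq y).scomp (φ' := fun s => s⁻¹) ?_ (hasDerivAt_inv h0)
  filter_upwards [isOpen_ne.mem_nhds h0] with s hs using Real.hasDerivAt_log hs

/-- Necessary first- and second-order conditions at a local minimum. -/
theorem HasLineJet.isLocalMin {f : E → ℝ} {y g : E} {H : E → ℝ} (h : HasLineJet f y g H)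
    (hmin : IsLocalMin f y) : g = 0 ∧ ∀ e, 0 ≤ H e := by
  have hline : ∀ e, IsLocalMin (fun t : ℝ => f (y + t • e)) 0 := fun e => by
    have hc : Tendsto (fun t : ℝ => y + t • e) (𝓝 0) (𝓝 y) := by
      have : Continuous fun t : ℝ => y + t • e := by fun_prop
      simpa using this.tendsto 0
    have := hc.eventually hmin
    simpa [IsLocalMin, IsMinFilter] using this
  have hg : ∀ e, inner ℝ g e = 0 := fun e => by
    obtain ⟨d, a, b, c⟩ := h e
    rw [← b]
    exact (hline e).hasDerivAt_eq_zero a.self_of_nhds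
  refine ⟨inner_self_eq_zero.1 (hg g), fun e => ?_⟩
  obtain ⟨d, a, b, c⟩ := h e
  by_contra! hneg
  have hd : deriv (fun t : ℝ => f (y + t • e)) =ᶠ[𝓝 0] d := a.mono fun t ht => ht.deriv
  have h2 : deriv (deriv (fun t : ℝ => f (y + t • e))) 0 = H e := by
    rw [hd.deriv_eq, c.deriv]
  -- With a negative second derivative the point would also be a local maximum, so the function
  -- would be locally constant and its second derivative zero.
  have hmax := isLocalMax_of_deriv_deriv_neg (h2.trans_lt hneg)
    (by rw [a.self_of_nhds.deriv, b, hg]) a.self_of_nhds.continuousAt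
  have hconst : (fun t : ℝ => f (y + t • e)) =ᶠ[𝓝 0] fun _ => f (y + (0 : ℝ) • e) := by
    filter_upwards [hmax, hline e] with t h1 h2 using le_antisymm h1 h2
  have h3 := hconst.deriv.deriv_eq
  rw [h2] at h3
  simp at h3
  exact hneg.ne h3

/-- Derivative of a function along a curve, and below of its first derivative applied to a moving
vector; together they give the second derivative along the curve. -/
theorem hasDerivAt_comp_curve {u : E → ℝ} (hu : ContDiff ℝ 2 u) {z : ℝ → E} {z' : E} {t : ℝ}
    (hz : HasDerivAt z z' t) :
    HasDerivAt (fun t => u (z t)) (fderiv ℝ u (z t) z') t :=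
  ((hu.differentiable (by norm_num)) (z t)).hasFDerivAt.comp_hasDerivAt t hz

theorem hasDerivAt_fderiv_comp_curve {u : E → ℝ} (hu : ContDiff ℝ 2 u) {z w : ℝ → E} {z' w' : E}
    {t : ℝ} (hz : HasDerivAt z z' t) (hw : HasDerivAt w w' t) :
    HasDerivAt (fun t => fderiv ℝ u (z t) (w t))
      (fderiv ℝ (fderiv ℝ u) (z t) z' (w t) + fderiv ℝ u (z t) w') t := by
  have h1 : Differentiable ℝ (fderiv ℝ u) :=
    (hu.fderiv_right (m := 1) (by norm_num)).differentiable (by norm_num)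
  exact ((h1 (z t)).hasFDerivAt.comp_hasDerivAt t hz).clm_apply hw

theorem hasLineJet_of_contDiff [CompleteSpace E] {u : E → ℝ} (hu : ContDiff ℝ 2 u) (y : E) :
    HasLineJet u y (gradient u y) (fun e => fderiv ℝ (fderiv ℝ u) y e e) := by
  intro e
  have hz : ∀ t : ℝ, HasDerivAt (fun t : ℝ => y + t • e) e t := fun t => by
    simpa using ((hasDerivAt_id t).smul_const e).const_add y
  refine ⟨fun t => fderiv ℝ u (y + t • e) e,
    Eventually.of_forall fun t => hasDerivAt_comp_curve hu (hz t), ?_, ?_⟩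
  · simp [inner_gradient_left]
  · simpa using hasDerivAt_fderiv_comp_curve hu (hz 0) (hasDerivAt_const (0 : ℝ) e)

end LineJet

/-! ### The Kelvin transform -/

section Kelvin

variable {n : ℕ}

/-- The transform `v(y) = |y|² u(y / |y|²)` of `u` under inversion in the unit sphere; the metric
`v⁻² |dy|²` is the pullback of `u⁻² |dx|²`. -/
def kelvin (u : EuclideanSpace ℝ (Fin n) → ℝ) (y : EuclideanSpace ℝ (Fin n)) : ℝ :=
  ‖y‖ ^ 2 * u ((‖y‖ ^ 2)⁻¹ • y)

theorem reflection_orthogonal_singleton_apply {E : Type*} [NormedAddCommGroup E]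
    [InnerProductSpace ℝ E] (y e : E) :
    (ℝ ∙ y)ᗮ.reflection e = e - (2 * inner ℝ y e / ‖y‖ ^ 2) • y := by
  simp only [Submodule.reflection_orthogonal_apply, Submodule.reflection_singleton_apply,
    RCLike.ofReal_real_eq_id, id]
  module

/-- The conformal covariance of the conformal Hessian under inversion: the quadratic form of
`kelvin u` at `y` is that of `u` at the inverted point, reflected in the hyperplane orthogonal to
`y` and divided by `|y|²`. -/
theorem hasLineJet_kelvin {u : EuclideanSpace ℝ (Fin n) → ℝ} (hu : ContDiff ℝ 2 u)
    (hpos : ∀ x, 0 < u x) {y : EuclideanSpace ℝ (Fin n)} (hy : y ≠ 0) :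
    ∃ g H, HasLineJet (kelvin u) y g H ∧
      ∀ e, H e - ‖g‖ ^ 2 / (2 * kelvin u y) * ‖e‖ ^ 2 =
        (‖y‖ ^ 2)⁻¹ * conformalForm u ((‖y‖ ^ 2)⁻¹ • y) ((ℝ ∙ y)ᗮ.reflection e) := by
  have hρ0 : 0 < ‖y‖ ^ 2 := by positivity
  set z₀ := (‖y‖ ^ 2)⁻¹ • y with hz₀
  set G := gradient u z₀ with hG
  refine ⟨(2 * u z₀) • y + (ℝ ∙ y)ᗮ.reflection G, fun e => 2 * ‖e‖ ^ 2 * u z₀ -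
    2 * ‖e‖ ^ 2 * (‖y‖ ^ 2)⁻¹ * inner ℝ G y + (‖y‖ ^ 2)⁻¹ *
      fderiv ℝ (fderiv ℝ u) z₀ ((ℝ ∙ y)ᗮ.reflection e) ((ℝ ∙ y)ᗮ.reflection e), ?_, ?_⟩
  · intro e
    -- The curve `z` is the inverted line, with velocity `w`.
    let ρ : ℝ → ℝ := fun t => ‖y + t • e‖ ^ 2
    let ρ' : ℝ → ℝ := fun t => 2 * inner ℝ y e + 2 * t * ‖e‖ ^ 2
    let z : ℝ → EuclideanSpace ℝ (Fin n) := fun t => (ρ t)⁻¹ • (y + t • e)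
    let w : ℝ → EuclideanSpace ℝ (Fin n) := fun t =>
      (ρ t)⁻¹ • e + (-ρ' t / ρ t ^ 2) • (y + t • e)
    have hl : ∀ t : ℝ, HasDerivAt (fun t : ℝ => y + t • e) e t := fun t => by
      simpa using ((hasDerivAt_id t).smul_const e).const_add y
    have hρ : ∀ t, HasDerivAt ρ (ρ' t) t := hasDerivAt_norm_add_smul_sq y e
    have hρ' : ∀ t, HasDerivAt ρ' (2 * ‖e‖ ^ 2) t := hasDerivAt_norm_add_smul_sq_deriv y e
    have hz : ∀ t, ρ t ≠ 0 → HasDerivAt z (w t) t := fun t ht =>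
      ((hρ t).inv ht).smul (hl t)
    have ρ0 : ρ 0 = ‖y‖ ^ 2 := by simp [ρ]
    have ρ'0 : ρ' 0 = 2 * inner ℝ y e := by simp [ρ']
    have z0 : z 0 = z₀ := by simp [z, hz₀, ρ0]
    have hev : ∀ᶠ t in 𝓝 (0 : ℝ), ρ t ≠ 0 :=
      (hρ 0).continuousAt.eventually_ne (by rw [ρ0]; exact hρ0.ne')
    have hne0 : ρ 0 ≠ 0 := by rw [ρ0]; exact hρ0.ne'
    have w0 : w 0 = (‖y‖ ^ 2)⁻¹ • (ℝ ∙ y)ᗮ.reflection e := by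
      rw [reflection_orthogonal_singleton_apply]
      simp only [w, ρ0, ρ'0, zero_smul, add_zero, smul_sub, smul_smul]
      rw [sub_eq_add_neg, ← neg_smul]
      congr 2
      field_simp
    refine ⟨fun t => ρ' t * u (z t) + ρ t * fderiv ℝ u (z t) (w t), ?_, ?_, ?_⟩
    · filter_upwards [hev] with t ht
      exact (hρ t).mul (hasDerivAt_comp_curve hu (hz t ht))
    · beta_reduce
      rw [z0, w0, ρ0, ρ'0, inner_add_left, real_inner_smul_left, map_smul, smul_eq_mul,
        mul_inv_cancel_left₀ hρ0.ne', ← inner_gradient_left, ← hG,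
        ← LinearIsometryEquiv.inner_map_map (ℝ ∙ y)ᗮ.reflection G, Submodule.reflection_reflection]
      ring
    · have hw : HasDerivAt w _ 0 := (((hρ 0).inv hne0).smul_const e).add
        (((hρ' 0).neg.div ((hρ 0).pow 2) (pow_ne_zero 2 hne0)).smul (hl 0))
      have := ((hρ' 0).mul (hasDerivAt_comp_curve hu (hz 0 hne0))).add
        ((hρ 0).mul (hasDerivAt_fderiv_comp_curve hu (hz 0 hne0) hw))
      refine this.congr_deriv ?_
      simp only [Pi.div_apply, Pi.neg_apply, Pi.pow_apply]
      rw [z0, w0, ρ0, ρ'0]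
      rw [reflection_orthogonal_singleton_apply]
      simp only [map_add, map_sub, map_smul, smul_eq_mul, zero_smul, add_zero, sub_apply,
        smul_apply, hG, inner_gradient_left]
      field_simp
      ring
  · intro e
    have hu0 := hpos z₀
    have hk : kelvin u y = ‖y‖ ^ 2 * u z₀ := rfl
    have hR : inner ℝ y ((ℝ ∙ y)ᗮ.reflection G) = -inner ℝ G y := by
      rw [reflection_orthogonal_singleton_apply, inner_sub_right, real_inner_smul_right,
        real_inner_self_eq_norm_sq, real_inner_comm]
      field_simp
      ring
    rw [hk, conformalForm, norm_add_sq_real, real_inner_smul_left, hR, norm_smul,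
      LinearIsometryEquiv.norm_map, LinearIsometryEquiv.norm_map, mul_pow, Real.norm_eq_abs,
      sq_abs, ← hG]
    field_simp
    ring

end Kelvin

/-! ### Superharmonic functions near an isolated singularity -/

section Comparison

variable {n : ℕ}

theorem rpow_neg_half_sq_mul {s : ℝ} (hs : 0 < s) : (s ^ (-1 / 2 : ℝ)) ^ 2 * s = 1 := by
  rw [← Real.rpow_natCast, ← Real.rpow_mul hs.le]
  norm_num
  rw [Real.rpow_neg_one]
  exact inv_mul_cancel₀ hs.ne'

/-- `ΔW ≤ 0` for `W = v ^ (-1/2)` whenever the conformal Hessian of `v` has nonnegative trace and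
`n ≥ 3`. -/
theorem sum_scomp_rpow_nonpos (hn : 3 ≤ n) {s : ℝ} (hs : 0 < s)
    (b : OrthonormalBasis (Fin n) ℝ (EuclideanSpace ℝ (Fin n))) {g : EuclideanSpace ℝ (Fin n)}
    {H : EuclideanSpace ℝ (Fin n) → ℝ} (h : 0 ≤ ∑ i, (H (b i) - ‖g‖ ^ 2 / (2 * s))) :
    ∑ i, ((-1 / 2) * ((-1 / 2 - 1) * s ^ (-1 / 2 - 1 - 1 : ℝ)) * (inner ℝ g (b i)) ^ 2 +
      (-1 / 2) * s ^ (-1 / 2 - 1 : ℝ) * H (b i)) ≤ 0 := by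
  have hA : 0 < s ^ (-1 / 2 - 1 - 1 : ℝ) := Real.rpow_pos_of_pos hs _
  have hAs : s ^ (-1 / 2 - 1 : ℝ) = s ^ (-1 / 2 - 1 - 1 : ℝ) * s := by
    rw [Real.rpow_sub_one hs.ne' (-1 / 2 - 1), div_mul_cancel₀ _ hs.ne']
  have hg : ∑ i, (inner ℝ g (b i)) ^ 2 = ‖g‖ ^ 2 := by
    rw [← b.sum_sq_norm_inner_left g]; simp
  rw [hAs, Finset.sum_add_distrib, ← Finset.mul_sum, ← Finset.mul_sum, hg]
  rw [Finset.sum_sub_distrib, Finset.sum_const, Finset.card_univ, Fintype.card_fin,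
    nsmul_eq_mul] at h
  have hn' : (3 : ℝ) ≤ n := by exact_mod_cast hn
  generalize s ^ (-1 / 2 - 1 - 1 : ℝ) = A at *
  generalize ∑ i, H (b i) = S at *
  have h1 : n * ‖g‖ ^ 2 ≤ 2 * (s * S) := by
    have : (n : ℝ) * (‖g‖ ^ 2 / (2 * s)) ≤ S := by linarith
    rw [mul_div_assoc', div_le_iff₀ (by positivity)] at this
    linarith
  have h2 : 3 * ‖g‖ ^ 2 ≤ 2 * (s * S) :=
    (mul_le_mul_of_nonneg_right hn' (sq_nonneg _)).trans h1
  nlinarith [mul_le_mul_of_nonneg_left h2 hA.le]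

/-- An isolated singularity is removable for the minimum principle of the positive superharmonic
function `v ^ (-1/2)`: if it dominates an affine function on the sphere of radius `r`, then also in
the punctured ball. The barrier is a small multiple of `-log |y|²`, which is strictly superharmonic
because `n ≥ 3`. -/
theorem affine_le_rpow_neg_half (hn : 3 ≤ n) {v : EuclideanSpace ℝ (Fin n) → ℝ}
    (hcont : ContinuousOn v {y | y ≠ 0}) (hpos : ∀ y, y ≠ 0 → 0 < v y)
    (hjet : ∀ y, y ≠ 0 → ∃ g H, ∃ b : OrthonormalBasis (Fin n) ℝ (EuclideanSpace ℝ (Fin n)),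
      HasLineJet v y g H ∧ 0 ≤ ∑ i, (H (b i) - ‖g‖ ^ 2 / (2 * v y)))
    {r a : ℝ} (hr : 0 < r) {p : EuclideanSpace ℝ (Fin n)}
    (hbd : ∀ y, ‖y‖ = r → a + inner ℝ p y ≤ v y ^ (-1 / 2 : ℝ))
    {y : EuclideanSpace ℝ (Fin n)} (hy0 : y ≠ 0) (hyr : ‖y‖ ≤ r) :
    a + inner ℝ p y ≤ v y ^ (-1 / 2 : ℝ) := by
  by_contra! hlt
  set D := a + inner ℝ p y - v y ^ (-1 / 2 : ℝ) with hD
  have hDpos : 0 < D := sub_pos.2 hlt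
  have hny : 0 < ‖y‖ := norm_pos_iff.2 hy0
  set T := Real.log (r ^ 2) - Real.log (‖y‖ ^ 2) with hT
  have hT0 : 0 ≤ T :=
    sub_nonneg.2 (Real.log_le_log (by positivity) (by gcongr))
  set η := D / (2 * (T + 1)) with hη
  have hη0 : 0 < η := by positivity
  have hηT : η * T < D := by
    rw [hη, div_mul_eq_mul_div, div_lt_iff₀ (by positivity)]
    nlinarith
  let G : EuclideanSpace ℝ (Fin n) → ℝ := fun x =>
    v x ^ (-1 / 2 : ℝ) - (a - η * Real.log (r ^ 2) + inner ℝ p x) - η * Real.log (‖x‖ ^ 2)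
  have hGy : G y < 0 := by
    simp only [G]
    have : η * T = η * Real.log (r ^ 2) - η * Real.log (‖y‖ ^ 2) := by rw [hT, mul_sub]
    linarith
  have hGr : ∀ x, ‖x‖ = r → 0 ≤ G x := fun x hx => by
    simp only [G, hx]
    linarith [hbd x hx]
  -- The logarithmic barrier makes `G` positive near the origin.
  obtain ⟨δ, hδ, hGδ⟩ : ∃ δ > 0, ∀ x, x ≠ 0 → ‖x‖ ≤ r → ‖x‖ ≤ δ → 0 < G x := by
    set B := |a| + ‖p‖ * r + 1 with hB
    have hB0 : 0 < B := by positivity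
    refine ⟨r * Real.exp (-(B / η)), by positivity, fun x hx hxr hxδ => ?_⟩
    have hnx : 0 < ‖x‖ := norm_pos_iff.2 hx
    have h1 : Real.log (‖x‖ ^ 2) ≤ Real.log (r ^ 2) - 2 * (B / η) := by
      rw [Real.log_pow, Real.log_pow]
      have := Real.log_le_log hnx hxδ
      rw [Real.log_mul hr.ne' (Real.exp_pos _).ne', Real.log_exp] at this
      push_cast
      linarith
    have h2 : η * Real.log (‖x‖ ^ 2) ≤ η * Real.log (r ^ 2) - 2 * B := by
      have := mul_le_mul_of_nonneg_left h1 hη0.le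
      have e : η * (2 * (B / η)) = 2 * B := by field_simp
      rw [mul_sub, e] at this
      exact this
    have h3 : inner ℝ p x ≤ ‖p‖ * r :=
      (real_inner_le_norm p x).trans (by gcongr)
    have h4 := le_abs_self a
    have h5 := Real.rpow_pos_of_pos (hpos x hx) (-1 / 2)
    simp only [G]
    linarith
  let K : Set (EuclideanSpace ℝ (Fin n)) := {x | δ ≤ ‖x‖ ∧ ‖x‖ ≤ r}
  have hK : IsCompact K := by
    refine (isCompact_closedBall (0 : EuclideanSpace ℝ (Fin n)) r).of_isClosed_subset ?_ ?_
    · exact (isClosed_le continuous_const continuous_norm).inter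
        (isClosed_le continuous_norm continuous_const)
    · intro x hx
      simpa using hx.2
  have hK0 : ∀ x ∈ K, x ≠ 0 := fun x hx => norm_pos_iff.1 (hδ.trans_le hx.1)
  have hyK : y ∈ K := by
    refine ⟨?_, hyr⟩
    by_contra! h
    exact (hGδ y hy0 hyr h.le).not_gt hGy
  have hGc : ContinuousOn G K := by
    refine ContinuousOn.sub (ContinuousOn.sub ?_ (by fun_prop)) (ContinuousOn.mul (by fun_prop) ?_)
    · exact (hcont.mono hK0).rpow_const fun x hx => Or.inl (hpos x (hK0 x hx)).ne'
    · exact ContinuousOn.log (by fun_prop) fun x hx =>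
        pow_ne_zero 2 (norm_ne_zero_iff.2 (hK0 x hx))
  obtain ⟨w, hwK, hw⟩ := hK.exists_isMinOn ⟨y, hyK⟩ hGc
  have hGw : G w < 0 := (hw hyK).trans_lt hGy
  have hw0 := hK0 w hwK
  have hwδ : δ < ‖w‖ := by
    by_contra! h
    exact (hGδ w hw0 hwK.2 h).not_gt hGw
  have hwr : ‖w‖ < r := lt_of_le_of_ne hwK.2 fun h => (hGr w h).not_gt hGw
  have hmin : IsLocalMin G w := by
    refine hw.isLocalMin ?_
    filter_upwards [(isOpen_lt continuous_const continuous_norm).mem_nhds hwδ,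
      (isOpen_lt continuous_norm continuous_const).mem_nhds hwr] with x h1 h2
    exact ⟨le_of_lt h1, le_of_lt h2⟩
  obtain ⟨g, H, b, hj, htr⟩ := hjet w hw0
  have hvw := hpos w hw0
  have hev : ∀ᶠ s in 𝓝 (v w), HasDerivAt (fun s : ℝ => s ^ (-1 / 2 : ℝ))
      ((-1 / 2) * s ^ (-1 / 2 - 1 : ℝ)) s := by
    filter_upwards [isOpen_ne.mem_nhds hvw.ne'] with s hs
      using Real.hasDerivAt_rpow_const (Or.inl hs)
  have hj1 := hj.scomp (φ' := fun s : ℝ => (-1 / 2) * s ^ (-1 / 2 - 1 : ℝ)) hev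
    ((Real.hasDerivAt_rpow_const (Or.inl hvw.ne')).const_mul (-1 / 2))
  have hj2 := (hj1.sub (hasLineJet_affine (a - η * Real.log (r ^ 2)) p w)).sub
    ((hasLineJet_log_norm_sq hw0).const_mul η)
  have hH := (hj2.isLocalMin hmin).2
  have hsum := Finset.sum_nonneg fun i (_ : i ∈ Finset.univ) => hH (b i)
  have h1 := sum_scomp_rpow_nonpos hn hvw b htr
  have hb : ∑ i, (inner ℝ w (b i)) ^ 2 = ‖w‖ ^ 2 := by
    rw [← b.sum_sq_norm_inner_left w]; simp
  have h2 : ∑ i, (-(((‖w‖ ^ 2) ^ 2)⁻¹) * (inner ℝ ((2 : ℝ) • w) (b i)) ^ 2 +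
        (‖w‖ ^ 2)⁻¹ * (2 * ‖b i‖ ^ 2)) = (2 * n - 4) / ‖w‖ ^ 2 := by
    simp only [real_inner_smul_left, mul_pow, b.norm_eq_one, one_pow]
    rw [Finset.sum_add_distrib, ← Finset.mul_sum, ← Finset.mul_sum, hb, Finset.sum_const,
      Finset.card_univ, Fintype.card_fin, nsmul_eq_mul]
    have : ‖w‖ ≠ 0 := norm_ne_zero_iff.2 hw0
    field_simp
    ring
  rw [Finset.sum_sub_distrib, ← Finset.mul_sum, h2] at hsum
  simp only [sub_zero] at hsum
  have hn' : (3 : ℝ) ≤ n := by exact_mod_cast hn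
  have h3 : 0 < η * ((2 * n - 4) / ‖w‖ ^ 2) :=
    mul_pos hη0 (div_pos (by linarith) (by have := norm_pos_iff.2 hw0; positivity))
  linarith

/-- The graph of `v` cannot have a downward conical singularity below a differentiable `F`
at the origin while approaching `F`. -/
theorem exists_gap_of_le_sub_norm (hn : 3 ≤ n) {v F : EuclideanSpace ℝ (Fin n) → ℝ}
    (hcont : ContinuousOn v {y | y ≠ 0}) (hpos : ∀ y, y ≠ 0 → 0 < v y)
    (hjet : ∀ y, y ≠ 0 → ∃ g H, ∃ b : OrthonormalBasis (Fin n) ℝ (EuclideanSpace ℝ (Fin n)),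
      HasLineJet v y g H ∧ 0 ≤ ∑ i, (H (b i) - ‖g‖ ^ 2 / (2 * v y)))
    (hF : DifferentiableAt ℝ F 0) (hF0 : 0 < F 0) {ε : ℝ} (hε : 0 < ε)
    (hle : ∀ y, y ≠ 0 → ‖y‖ ≤ 1 → v y ≤ F y - ε * ‖y‖) :
    ∃ δ > 0, ∀ y, y ≠ 0 → ‖y‖ < δ → δ ≤ F y - v y := by
  set q := gradient F 0 with hq
  have hlin : ∀ᶠ y in 𝓝 (0 : EuclideanSpace ℝ (Fin n)),
      F y ≤ F 0 + inner ℝ q y + ε / 2 * ‖y‖ := by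
    have h1 := hF.hasFDerivAt.isLittleO.def (half_pos hε)
    filter_upwards [h1] with y hy
    rw [sub_zero, Real.norm_eq_abs] at hy
    rw [hq, inner_gradient_left]
    linarith [le_abs_self (F y - F 0 - (fderiv ℝ F 0) y)]
  obtain ⟨r₀, hr₀, hball⟩ := Metric.eventually_nhds_iff.1 hlin
  set r := min (r₀ / 2) 1 with hr
  have hr0 : 0 < r := by positivity
  set X := F 0 ^ (-1 / 2 : ℝ) with hX
  have hX0 : 0 < X := Real.rpow_pos_of_pos hF0 _
  have hXF : X ^ 2 * F 0 = 1 := rpow_neg_half_sq_mul hF0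
  set κ := X ^ 3 * ε / 4 with hκ
  have hκ0 : 0 < κ := by positivity
  -- On the sphere of radius `r`, use that the graph of `s ↦ s ^ (-1/2)` lies above its tangent
  -- at `F 0`.
  have hsph : ∀ y, ‖y‖ = r →
      (X + κ * r) + inner ℝ ((-(X ^ 3 / 2)) • q) y ≤ v y ^ (-1 / 2 : ℝ) := by
    intro y hy
    have hy0 : y ≠ 0 := norm_pos_iff.1 (hy ▸ hr0)
    have hvy := hpos y hy0
    have h1 := hle y hy0 (hy ▸ min_le_right _ _)
    have h2 := hball (y := y) (by
      rw [dist_zero_right, hy]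
      exact (min_le_left _ _).trans_lt (half_lt_self hr₀))
    have h3 : v y ≤ F 0 + inner ℝ q y - ε / 2 * r := by rw [hy] at h1 h2; linarith
    have hw0 : 0 < v y ^ (-1 / 2 : ℝ) := Real.rpow_pos_of_pos hvy _
    have hw1 := rpow_neg_half_sq_mul hvy
    generalize v y ^ (-1 / 2 : ℝ) = w at *
    have hamgm : 3 / 2 * X - X ^ 3 / 2 * v y ≤ w := by
      have hv : v y = (w ^ 2)⁻¹ := eq_inv_of_mul_eq_one_right hw1
      rw [hv, sub_le_iff_le_add, ← sub_le_iff_le_add', ← div_eq_mul_inv,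
        le_div_iff₀ (by positivity)]
      nlinarith [mul_nonneg (sq_nonneg (w - X)) (by positivity : 0 ≤ 2 * w + X)]
    have h4 := mul_le_mul_of_nonneg_left h3 (by positivity : 0 ≤ X ^ 3 / 2)
    have h5 : X ^ 3 * F 0 = X := by
      rw [pow_succ, mul_right_comm, hXF, one_mul]
    rw [real_inner_smul_left, hκ]
    nlinarith
  have hin : ∀ y, y ≠ 0 → ‖y‖ ≤ r →
      (X + κ * r) + inner ℝ ((-(X ^ 3 / 2)) • q) y ≤ v y ^ (-1 / 2 : ℝ) :=
    fun y h0 h1 => affine_le_rpow_neg_half hn hcont hpos hjet hr0 hsph h0 h1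
  set Y := X + κ * r / 2 with hY
  have hXY : X < Y := by rw [hY]; linarith [mul_pos hκ0 hr0]
  have hY0 : 0 < Y := hX0.trans hXY
  set Δ := F 0 - (Y ^ 2)⁻¹ with hΔ
  have hΔ0 : 0 < Δ := by
    have : F 0 = (X ^ 2)⁻¹ := eq_inv_of_mul_eq_one_right hXF
    rw [hΔ, this, sub_pos]
    gcongr
  have hev1 : ∀ᶠ y in 𝓝 (0 : EuclideanSpace ℝ (Fin n)),
      Y < (X + κ * r) + inner ℝ ((-(X ^ 3 / 2)) • q) y := by
    have hc : Continuous fun y : EuclideanSpace ℝ (Fin n) =>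
        (X + κ * r) + inner ℝ ((-(X ^ 3 / 2)) • q) y := by fun_prop
    refine (isOpen_lt continuous_const hc).mem_nhds ?_
    simp only [Set.mem_ofPred_eq, inner_zero_right, hY]
    linarith [mul_pos hκ0 hr0]
  have hev2 : ∀ᶠ y in 𝓝 (0 : EuclideanSpace ℝ (Fin n)), F 0 - Δ / 2 < F y :=
    hF.continuousAt.eventually_const_lt (by linarith)
  obtain ⟨d, hd, hd'⟩ := Metric.eventually_nhds_iff.1 (hev1.and hev2)
  refine ⟨min (min d r) (Δ / 2), by positivity, fun y hy0 hy => ?_⟩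
  have hyd : ‖y‖ < d := hy.trans_le ((min_le_left _ _).trans (min_le_left _ _))
  have hyr : ‖y‖ < r := hy.trans_le ((min_le_left _ _).trans (min_le_right _ _))
  obtain ⟨h1, h2⟩ := hd' (y := y) (by rwa [dist_zero_right])
  have h3 := h1.le.trans (hin y hy0 hyr.le)
  have hvy := hpos y hy0
  have hw1 := rpow_neg_half_sq_mul hvy
  have h4 : v y ≤ (Y ^ 2)⁻¹ := by
    rw [eq_inv_of_mul_eq_one_right hw1]
    gcongr
  have := min_le_right (min d r) (Δ / 2)
  linarith

end Comparison

/-! ### Comparison with the Kelvin transform -/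

section KelvinComparison

variable {n : ℕ}

theorem hasLineJet_bubble (p y : EuclideanSpace ℝ (Fin n)) :
    HasLineJet (fun x => 1 + ‖x‖ ^ 2 + inner ℝ p x) y ((2 : ℝ) • y + p)
      (fun e => 2 * ‖e‖ ^ 2) := by
  have := (hasLineJet_norm_sq y).add (hasLineJet_affine 1 p y)
  simp only [add_zero] at this
  convert this using 2
  ring

/-- The squared norm over the height is jointly subadditive. -/
theorem norm_add_sq_div_le {E : Type*} [NormedAddCommGroup E] [InnerProductSpace ℝ E] (a b : E)
    {s t : ℝ} (hs : 0 < s) (ht : 0 < t) :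
    ‖a + b‖ ^ 2 / (s + t) ≤ ‖a‖ ^ 2 / s + ‖b‖ ^ 2 / t := by
  have : 0 ≤ ‖t • a - s • b‖ ^ 2 := sq_nonneg _
  rw [norm_sub_sq_real, real_inner_smul_left, real_inner_smul_right, norm_smul, norm_smul,
    mul_pow, mul_pow, Real.norm_eq_abs, Real.norm_eq_abs, sq_abs, sq_abs] at this
  rw [norm_add_sq_real, div_add_div _ _ hs.ne' ht.ne', div_le_div_iff₀ (by positivity)
    (by positivity)]
  nlinarith

theorem bubble_pos {p : EuclideanSpace ℝ (Fin n)} (hp : ‖p‖ ≤ 1) (x : EuclideanSpace ℝ (Fin n)) :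
    0 < 1 + ‖x‖ ^ 2 + inner ℝ p x := by
  have h1 := (abs_le.1 (abs_real_inner_le_norm p x)).1
  nlinarith [sq_nonneg (‖x‖ - 1), norm_nonneg x, mul_le_mul_of_nonneg_right hp (norm_nonneg x)]

/-- A multiple of `u` cannot touch `kelvin u + ε (1 + |x|² + ⟨p, x⟩)` from above away from the
origin. The quadratic polynomial is a bubble, whose conformal Hessian is positive definite, and the
conformal Hessian is superadditive; so touching would push the conformal Hessian of `u` at one point
strictly above that at the inverted point. -/
theorem IsDegenerateSolution.not_touching {u : EuclideanSpace ℝ (Fin n) → ℝ}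
    (hu : IsDegenerateSolution u) {p y : EuclideanSpace ℝ (Fin n)} (hp : ‖p‖ ≤ 1) (hy : y ≠ 0)
    {ε N : ℝ} (hε : 0 < ε) (hN : 0 < N)
    (hval : N * u y = kelvin u y + ε * (1 + ‖y‖ ^ 2 + inner ℝ p y)) :
    ¬ IsLocalMin (fun x => N * u x - (kelvin u x + ε * (1 + ‖x‖ ^ 2 + inner ℝ p x))) y := by
  intro hmin
  obtain ⟨g, H, hj, hcov⟩ := hasLineJet_kelvin hu.contDiff hu.pos hy
  have hjet := ((hasLineJet_of_contDiff hu.contDiff y).const_mul N).sub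
    (hj.add ((hasLineJet_bubble p y).const_mul ε))
  obtain ⟨hg, hH⟩ := hjet.isLocalMin hmin
  have hρ : 0 < ‖y‖ ^ 2 := by have := norm_pos_iff.2 hy; positivity
  have hh := bubble_pos hp y
  have hv : 0 < kelvin u y := mul_pos hρ (hu.pos _)
  have hq : ‖(2 : ℝ) • y + p‖ ^ 2 = 4 * ‖y‖ ^ 2 + 4 * inner ℝ p y + ‖p‖ ^ 2 := by
    rw [norm_add_sq_real, real_inner_smul_left, norm_smul, mul_pow, real_inner_comm]
    norm_num
    ring
  have hp2 : ‖p‖ ^ 2 ≤ 1 := pow_le_one₀ (norm_nonneg _) hp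
  set h := 1 + ‖y‖ ^ 2 + inner ℝ p y with hhdef
  have hq' : ‖(2 : ℝ) • y + p‖ ^ 2 = 4 * h - (4 - ‖p‖ ^ 2) := by rw [hq, hhdef]; ring
  set c := (4 - ‖p‖ ^ 2) / (2 * h) with hc
  have hc0 : 0 < c := by
    rw [hc]
    exact div_pos (by linarith) (by positivity)
  have hgrad : N • gradient u y = g + ε • ((2 : ℝ) • y + p) := sub_eq_zero.1 hg
  have hsup := norm_add_sq_div_le g (ε • ((2 : ℝ) • y + p)) hv (mul_pos hε hh)
  rw [← hgrad, ← hval, norm_smul, norm_smul, mul_pow, mul_pow, Real.norm_eq_abs, Real.norm_eq_abs,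
    sq_abs, sq_abs, hq'] at hsup
  have hu0 := hu.pos y
  have e1 : N ^ 2 * ‖gradient u y‖ ^ 2 / (N * u y) = 2 * (N * (‖gradient u y‖ ^ 2 / (2 * u y))) := by
    field_simp
  have e2 : ε ^ 2 * (4 * h - (4 - ‖p‖ ^ 2)) / (ε * h) = 2 * (ε * (2 - c)) := by
    rw [hc]
    field_simp
    ring
  have e3 : ‖g‖ ^ 2 / kelvin u y = 2 * (‖g‖ ^ 2 / (2 * kelvin u y)) := by
    field_simp
  rw [e1, e2, e3] at hsup
  refine hu.not_lt y ((‖y‖ ^ 2)⁻¹ • y) (ℝ ∙ y)ᗮ.reflection ((‖y‖ ^ 2)⁻¹ / N) (ε * c / N)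
    (by positivity) (by positivity) fun e => ?_
  have he := hH e
  have hcov := hcov e
  have h1 := mul_le_mul_of_nonneg_right hsup (sq_nonneg ‖e‖)
  have h2 : (‖y‖ ^ 2)⁻¹ * conformalForm u ((‖y‖ ^ 2)⁻¹ • y) ((ℝ ∙ y)ᗮ.reflection e) +
      ε * c * ‖e‖ ^ 2 ≤ N * conformalForm u y e := by
    rw [← hcov, conformalForm]
    nlinarith
  calc _ = ((‖y‖ ^ 2)⁻¹ * conformalForm u ((‖y‖ ^ 2)⁻¹ • y) ((ℝ ∙ y)ᗮ.reflection e) +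
      ε * c * ‖e‖ ^ 2) / N := by ring
    _ ≤ _ := by rw [div_le_iff₀ hN]; linarith

theorem continuousOn_kelvin {u : EuclideanSpace ℝ (Fin n) → ℝ} (hu : Continuous u) :
    ContinuousOn (kelvin u) {y | y ≠ 0} := by
  have h1 : ContinuousOn (fun y : EuclideanSpace ℝ (Fin n) => (‖y‖ ^ 2)⁻¹ • y) {y | y ≠ 0} :=
    ContinuousOn.smul (ContinuousOn.inv₀ (by fun_prop) fun x hx =>
      pow_ne_zero 2 (norm_ne_zero_iff.2 hx)) continuousOn_id
  exact ContinuousOn.mul (by fun_prop) (hu.comp_continuousOn h1)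

theorem IsDegenerateSolution.kelvin_jet {u : EuclideanSpace ℝ (Fin n) → ℝ}
    (hu : IsDegenerateSolution u) (y : EuclideanSpace ℝ (Fin n)) (hy : y ≠ 0) :
    ∃ g H, ∃ b : OrthonormalBasis (Fin n) ℝ (EuclideanSpace ℝ (Fin n)),
      HasLineJet (kelvin u) y g H ∧ 0 ≤ ∑ i, (H (b i) - ‖g‖ ^ 2 / (2 * kelvin u y)) := by
  obtain ⟨g, H, hj, hcov⟩ := hasLineJet_kelvin hu.contDiff hu.pos hy
  obtain ⟨b, hb⟩ := hu.trace_nonneg ((‖y‖ ^ 2)⁻¹ • y)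
  refine ⟨g, H, b.map (ℝ ∙ y)ᗮ.reflection, hj, ?_⟩
  have : ∀ i, H (b.map (ℝ ∙ y)ᗮ.reflection i) - ‖g‖ ^ 2 / (2 * kelvin u y) =
      (‖y‖ ^ 2)⁻¹ * conformalForm u ((‖y‖ ^ 2)⁻¹ • y) (b i) := fun i => by
    have h := hcov (b.map (ℝ ∙ y)ᗮ.reflection i)
    rw [OrthonormalBasis.norm_eq_one, one_pow, mul_one] at h
    rw [h, OrthonormalBasis.map_apply, Submodule.reflection_reflection]
  simp only [this]
  rw [← Finset.mul_sum]
  positivity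

/-- An entire solution dominates its Kelvin transform in the unit ball. -/
theorem IsDegenerateSolution.kelvin_le (hn : 3 ≤ n) {u : EuclideanSpace ℝ (Fin n) → ℝ}
    (hu : IsDegenerateSolution u) {y : EuclideanSpace ℝ (Fin n)} (hy : y ≠ 0) (hy1 : ‖y‖ ≤ 1) :
    kelvin u y ≤ u y := by
  by_contra! hlt
  have hcu : Continuous u := hu.contDiff.continuous
  have hcv := continuousOn_kelvin hcu
  have hv : ∀ x, x ≠ 0 → 0 < kelvin u x := fun x hx =>
    mul_pos (by have := norm_pos_iff.2 hx; positivity) (hu.pos _)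
  have hsph : ∀ x : EuclideanSpace ℝ (Fin n), ‖x‖ = 1 → kelvin u x = u x := fun x hx => by
    simp [kelvin, hx]
  have hball := isCompact_closedBall (0 : EuclideanSpace ℝ (Fin n)) 1
  obtain ⟨m, hm, hmu⟩ : ∃ m > 0, ∀ x : EuclideanSpace ℝ (Fin n), ‖x‖ ≤ 1 → m ≤ u x := by
    obtain ⟨w, _, hw⟩ := hball.exists_isMinOn ⟨0, by simp⟩ hcu.continuousOn
    exact ⟨u w, hu.pos w, fun x hx => hw (by simpa using hx)⟩
  obtain ⟨M, hMu⟩ : ∃ M, ∀ x : EuclideanSpace ℝ (Fin n), ‖x‖ ≤ 1 → u x ≤ M := by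
    obtain ⟨w, _, hw⟩ := hball.exists_isMaxOn ⟨0, by simp⟩ hcu.continuousOn
    exact ⟨u w, fun x hx => hw (by simpa using hx)⟩
  have hM : 0 < M := (hu.pos 0).trans_le (hMu 0 (by simp))
  have hvM : ∀ x, x ≠ 0 → ‖x‖ ≤ 1 → kelvin u x ≤ M := by
    intro x hx hx1
    have hneg : (-1 / 2 : ℝ) < 0 := by norm_num
    have := affine_le_rpow_neg_half hn hcv hv hu.kelvin_jet (r := 1) (a := M ^ (-1 / 2 : ℝ))
      (p := 0) one_pos (fun z hz => by
        have hz0 : z ≠ 0 := norm_pos_iff.1 (hz ▸ one_pos)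
        rw [inner_zero_left, add_zero, Real.rpow_le_rpow_iff_of_neg hM (hv z hz0) hneg, hsph z hz]
        exact hMu z hz.le) hx hx1
    rwa [inner_zero_left, add_zero, Real.rpow_le_rpow_iff_of_neg hM (hv x hx) hneg] at this
  have huy := hu.pos y
  set q := kelvin u y / u y with hq
  have hq1 : 1 < q := (one_lt_div huy).2 hlt
  -- `ε` is small enough to keep the perturbed quotient below `q` on the unit sphere.
  obtain ⟨ε, hε, hεm, hεq⟩ : ∃ ε > 0, ε < m ∧ 3 * ε < (q - 1) * m := by
    have : 0 < (q - 1) * m := mul_pos (by linarith) hm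
    exact ⟨min (m / 2) ((q - 1) * m / 6), by positivity,
      (min_le_left _ _).trans_lt (by linarith), by
        have := min_le_right (m / 2) ((q - 1) * m / 6)
        linarith⟩
  let f : EuclideanSpace ℝ (Fin n) → EuclideanSpace ℝ (Fin n) → ℝ := fun p x =>
    (kelvin u x + ε * (1 + ‖x‖ ^ 2 + inner ℝ p x)) / u x
  let S : Set (EuclideanSpace ℝ (Fin n)) := {x | x ≠ 0 ∧ ‖x‖ ≤ 1}
  have hyS : y ∈ S := ⟨hy, hy1⟩
  have hbdd : BddAbove (f 0 '' S) := by
    refine ⟨(M + ε * 2) / m, ?_⟩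
    rintro _ ⟨x, hx, rfl⟩
    have h1 := hvM x hx.1 hx.2
    have h2 : ‖x‖ ^ 2 ≤ 1 := pow_le_one₀ (norm_nonneg _) hx.2
    have h3 := hv x hx.1
    simp only [f, inner_zero_left, add_zero]
    refine div_le_div₀ (by positivity) ?_ hm (hmu x hx.2)
    nlinarith
  set N := sSup (f 0 '' S) with hNdef
  have hfN : ∀ x ∈ S, f 0 x ≤ N := fun x hx => le_csSup hbdd ⟨x, hx, rfl⟩
  have hqN : q < N := by
    refine lt_of_lt_of_le ?_ (hfN y hyS)
    simp only [f, hq, inner_zero_left, add_zero]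
    gcongr
    have : 0 < ε * (1 + ‖y‖ ^ 2) := by positivity
    linarith
  have hN0 : 0 < N := by linarith
  -- The supremum is approached only at the origin, where all the bubbles agree; so it is the same
  -- for all of them.
  have hall : ∀ p : EuclideanSpace ℝ (Fin n), ‖p‖ ≤ 1 → ∀ x ∈ S, f p x ≤ N := by
    intro p hp x₁ hx₁
    by_contra! hK
    set K := f p x₁ with hKdef
    have hbound : ∀ x ∈ S, f p x ≤ N + ε * ‖x‖ / m := by
      intro x hx
      have h1 : f p x = f 0 x + ε * inner ℝ p x / u x := by
        simp only [f, inner_zero_left, add_zero]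
        ring
      have h2 : ε * inner ℝ p x / u x ≤ ε * ‖x‖ / m := by
        refine div_le_div₀ (by positivity) ?_ hm (hmu x hx.2)
        gcongr
        exact (real_inner_le_norm p x).trans
          (mul_le_of_le_one_left (norm_nonneg _) hp)
      rw [h1]
      linarith [hfN x hx]
    set δ := (K - N) * m / (2 * ε) with hδ
    have hδ0 : 0 < δ := by
      have : 0 < K - N := sub_pos.2 hK
      positivity
    have hnear : ∀ x ∈ S, ‖x‖ ≤ δ → f p x < K := by
      intro x hx hxδ
      refine (hbound x hx).trans_lt ?_
      have : ε * ‖x‖ / m ≤ ε * δ / m := by gcongr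
      have e : ε * δ / m = (K - N) / 2 := by rw [hδ]; field_simp
      linarith
    have hfar : ∀ x, ‖x‖ = 1 → f p x < K := by
      intro x hx
      have hux := hmu x hx.le
      refine lt_trans ?_ (hqN.trans hK)
      have h1 : inner ℝ p x ≤ 1 := (real_inner_le_norm p x).trans (by rw [hx, mul_one]; exact hp)
      simp only [f]
      rw [div_lt_iff₀ (hu.pos x), hsph x hx, hx]
      nlinarith
    let A : Set (EuclideanSpace ℝ (Fin n)) := {x | δ ≤ ‖x‖ ∧ ‖x‖ ≤ 1}
    have hAS : ∀ x ∈ A, x ∈ S := fun x hx => ⟨norm_pos_iff.1 (hδ0.trans_le hx.1), hx.2⟩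
    have hA : IsCompact A := by
      refine hball.of_isClosed_subset ?_ fun x hx => by simpa using hx.2
      exact (isClosed_le continuous_const continuous_norm).inter
        (isClosed_le continuous_norm continuous_const)
    have hx₁A : x₁ ∈ A := ⟨by
      by_contra! h
      exact lt_irrefl _ (hnear x₁ hx₁ h.le), hx₁.2⟩
    have hfc : ContinuousOn (f p) A := by
      refine ContinuousOn.div (ContinuousOn.add (hcv.mono fun x hx => (hAS x hx).1) (by fun_prop))
        hcu.continuousOn fun x _ => (hu.pos x).ne'
    obtain ⟨w, hwA, hw⟩ := hA.exists_isMaxOn ⟨x₁, hx₁A⟩ hfc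
    have hKw : K ≤ f p w := hw hx₁A
    have hwS := hAS w hwA
    have hwδ : δ < ‖w‖ := by
      by_contra! h
      exact (hnear w hwS h).not_ge hKw
    have hw1 : ‖w‖ < 1 := lt_of_le_of_ne hwS.2 fun h => (hfar w h).not_ge hKw
    have hval : f p w * u w = kelvin u w + ε * (1 + ‖w‖ ^ 2 + inner ℝ p w) :=
      div_mul_cancel₀ _ (hu.pos w).ne'
    refine hu.not_touching hp hwS.1 hε (hN0.trans (hK.trans_le hKw)) hval ?_
    filter_upwards [(isOpen_lt continuous_const continuous_norm).mem_nhds hwδ,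
      (isOpen_lt continuous_norm continuous_const).mem_nhds hw1] with x h1 h2
    have h3 : f p x ≤ f p w := hw (⟨le_of_lt h1, le_of_lt h2⟩ : x ∈ A)
    rw [hval, sub_self, sub_nonneg]
    exact (div_le_iff₀ (hu.pos x)).1 h3
  -- Optimising over the bubbles gives a conical gap, which the removable singularity excludes.
  have hcone : ∀ x, x ≠ 0 → ‖x‖ ≤ 1 →
      kelvin u x ≤ (N * u x - ε * (1 + ‖x‖ ^ 2)) - ε * ‖x‖ := by
    intro x hx hx1
    have hnx := norm_pos_iff.2 hx
    have h := hall (‖x‖⁻¹ • x) (by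
      rw [norm_smul, norm_inv, norm_norm, inv_mul_cancel₀ hnx.ne']) x ⟨hx, hx1⟩
    have e : inner ℝ (‖x‖⁻¹ • x) x = ‖x‖ := by
      rw [real_inner_smul_left, real_inner_self_eq_norm_sq]
      field_simp
    simp only [f] at h
    rw [div_le_iff₀ (hu.pos x), e] at h
    linarith
  have hF0 : 0 < N * u 0 - ε * (1 + ‖(0 : EuclideanSpace ℝ (Fin n))‖ ^ 2) := by
    have := hmu 0 (by simp)
    rw [norm_zero]
    nlinarith
  obtain ⟨δ, hδ, hgap⟩ := exists_gap_of_le_sub_norm hn hcv hv hu.kelvin_jet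
    (F := fun x => N * u x - ε * (1 + ‖x‖ ^ 2))
    ((((hu.contDiff.differentiable (by norm_num)) 0).const_mul N).sub
      (((differentiableAt_id.norm_sq ℝ).const_add 1).const_mul ε)) hF0 hε hcone
  obtain ⟨_, ⟨x, hx, rfl⟩, hxN⟩ := exists_lt_of_lt_csSup (⟨_, y, hyS, rfl⟩ : (f 0 '' S).Nonempty)
    (sub_lt_self N (show 0 < min δ (ε * δ) / M by positivity))
  have h1 : N * u x - ε * (1 + ‖x‖ ^ 2) - kelvin u x < min δ (ε * δ) := by
    simp only [f, inner_zero_left, add_zero] at hxN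
    rw [lt_div_iff₀ (hu.pos x), sub_mul] at hxN
    have : min δ (ε * δ) / M * u x ≤ min δ (ε * δ) := by
      rw [div_mul_eq_mul_div, div_le_iff₀ hM]
      exact mul_le_mul_of_nonneg_left (hMu x hx.2) (by positivity)
    linarith
  have h2 : ‖x‖ < δ := by
    have := hcone x hx.1 hx.2
    have := h1.trans_le (min_le_right _ _)
    nlinarith
  have h3 := hgap x hx.1 h2
  exact (h1.trans_le (min_le_left _ _)).not_ge h3

end KelvinComparison

/-! ### Similarities and the Liouville theorem -/

section Liouville

variable {n : ℕ}

theorem fderiv_comp_add_smul {E G : Type*} [NormedAddCommGroup E] [NormedSpace ℝ E]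
    [NormedAddCommGroup G] [NormedSpace ℝ G] (f : E → G) (c : E) (r : ℝ) (y : E) :
    fderiv ℝ (fun x => f (c + r • x)) y = r • fderiv ℝ f (c + r • y) := by
  rw [fderiv_comp_smul (f := fun z => f (c + z)), fderiv_comp_add_left]

theorem conformalForm_comp_add_smul {u : EuclideanSpace ℝ (Fin n) → ℝ} (hu : ContDiff ℝ 2 u)
    (c : EuclideanSpace ℝ (Fin n)) (r : ℝ) (y e : EuclideanSpace ℝ (Fin n)) :
    conformalForm (fun x => u (c + r • x)) y e = r ^ 2 * conformalForm u (c + r • y) e := by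
  have h1 : fderiv ℝ (fun x => u (c + r • x)) = fun y => r • fderiv ℝ u (c + r • y) :=
    funext fun y => fderiv_comp_add_smul u c r y
  have hd : Differentiable ℝ (fderiv ℝ u) :=
    (hu.fderiv_right (m := 1) (by norm_num)).differentiable (by norm_num)
  have h2 : gradient (fun x => u (c + r • x)) y = r • gradient u (c + r • y) := by
    rw [gradient, h1, map_smul]
    rfl
  have hd' : DifferentiableAt ℝ (fun y => fderiv ℝ u (c + r • y)) y := by fun_prop
  have h3 : fderiv ℝ (fun y => r • fderiv ℝ u (c + r • y)) y =
      r • r • fderiv ℝ (fderiv ℝ u) (c + r • y) :=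
    (fderiv_fun_const_smul hd' r).trans (by rw [fderiv_comp_add_smul])
  rw [conformalForm, h2, h1, h3, conformalForm, norm_smul, mul_pow, Real.norm_eq_abs, sq_abs]
  simp only [smul_apply, smul_eq_mul]
  ring

theorem IsDegenerateSolution.comp_add_smul {u : EuclideanSpace ℝ (Fin n) → ℝ}
    (hu : IsDegenerateSolution u) (c : EuclideanSpace ℝ (Fin n)) {r : ℝ} (hr : 0 < r) :
    IsDegenerateSolution (fun x => u (c + r • x)) where
  contDiff := hu.contDiff.comp (by fun_prop)
  pos x := hu.pos _
  trace_nonneg x := by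
    obtain ⟨b, hb⟩ := hu.trace_nonneg (c + r • x)
    refine ⟨b, ?_⟩
    simp only [conformalForm_comp_add_smul hu.contDiff]
    rw [← Finset.mul_sum]
    positivity
  not_lt x z R κ d hκ hd h := by
    refine hu.not_lt (c + r • x) (c + r • z) R κ (d / r ^ 2) hκ (by positivity) fun e => ?_
    have he := h e
    rw [conformalForm_comp_add_smul hu.contDiff, conformalForm_comp_add_smul hu.contDiff] at he
    have hr2 : 0 < r ^ 2 := by positivity
    refine le_of_mul_le_mul_left ?_ hr2
    have e1 : r ^ 2 * (d / r ^ 2 * ‖e‖ ^ 2) = d * ‖e‖ ^ 2 := by field_simp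
    rw [mul_add, e1]
    linarith

/-- Inversions centred on the line through `x` and `z` that interchange these two points, with the
centre receding to infinity beyond `x`, show `u z ≤ u x`. -/
theorem IsDegenerateSolution.le (hn : 3 ≤ n) {u : EuclideanSpace ℝ (Fin n) → ℝ}
    (hu : IsDegenerateSolution u) (x z : EuclideanSpace ℝ (Fin n)) : u z ≤ u x := by
  rcases eq_or_ne z x with rfl | hzx
  · exact le_rfl
  set d := z - x with hd
  have hd0 : d ≠ 0 := sub_ne_zero.2 hzx
  have hnd := norm_pos_iff.2 hd0
  have key : ∀ T : ℝ, 0 < T → T * u z ≤ (T + 1) * u x := by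
    intro T hT
    -- The inversion has centre `c` and radius `r`.
    set c := x - T • d with hc
    set r := √(T * (T + 1)) * ‖d‖ with hr
    have hr0 : 0 < r := by positivity
    have hr2 : r ^ 2 = T * (T + 1) * ‖d‖ ^ 2 := by
      rw [hr, mul_pow, Real.sq_sqrt (by positivity)]
    set y := (T / r) • d with hy
    have hy0 : y ≠ 0 := smul_ne_zero (by positivity) hd0
    have hy2 : ‖y‖ ^ 2 = T / (T + 1) := by
      rw [hy, norm_smul, mul_pow, Real.norm_eq_abs, sq_abs, div_pow, hr2]
      field_simp
    have hy1 : ‖y‖ ≤ 1 := by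
      have : ‖y‖ ^ 2 ≤ 1 := by
        rw [hy2, div_le_one (by positivity)]
        linarith
      exact (sq_le_one_iff₀ (norm_nonneg _)).1 this
    have h := (hu.comp_add_smul c hr0).kelvin_le hn hy0 hy1
    have e1 : c + r • y = x := by
      rw [hy, smul_smul, mul_div_cancel₀ _ hr0.ne', hc, sub_add_cancel]
    have e2 : c + r • (‖y‖ ^ 2)⁻¹ • y = z := by
      have : r * (T / (T + 1))⁻¹ * (T / r) = T + 1 := by field_simp
      rw [hy2, hy, smul_smul, smul_smul, this, hc, add_smul, one_smul, hd]
      abel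
    simp only [kelvin] at h
    rw [e1, e2, hy2, div_mul_eq_mul_div, div_le_iff₀ (by positivity)] at h
    linarith
  by_contra! hlt
  have h1 := hu.pos x
  have hgap : 0 < u z - u x := sub_pos.2 hlt
  have := key (2 * u x / (u z - u x)) (by positivity)
  have e : 2 * u x / (u z - u x) * (u z - u x) = 2 * u x := div_mul_cancel₀ _ hgap.ne'
  linarith

end Liouville

end KYamabe

end

theorem corollary3p1 (n k : ℕ) (hn : 3 ≤ n) (hk : 1 ≤ k) (hkn : k ≤ n)
    (u : EuclideanSpace ℝ (Fin n) → ℝ) (hu : ContDiff ℝ 3 u) (hpos : ∀ x, 0 < u x)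
    (hadm : KYamabe.IsAdmissible k (hu.of_le (by norm_num)))
    (heq : ∀ x, KYamabe.sigma k
      (KYamabe.conformalEigenvalues (hu.of_le (by norm_num)) x) = 0) :
    ∃ c : ℝ, ∀ x, u x = c := by
  have h := KYamabe.isDegenerateSolution_of_sigma_eq_zero hk (hu.of_le (by norm_num)) hpos hadm heq
  exact ⟨u 0, fun x => le_antisymm (h.le hn 0 x) (h.le hn x 0)⟩
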